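/- Let $n\ge 2$, $I_n=\{1,\dots,n\}$, and let $\mathcal H$ be a complex Hilbert space. Let $\{U_{ij}\}_{1\le i<j\le n}$ be commuting unitaries on $\mathcal H$, put $U_{ji}:=U_{ij}^*$ for $i<j$, and let $V=(V_1,\dots,V_n)$ be a $\mathcal U_n$-twisted isometry with respect to $\{U_{ij}\}_{i<j}$, that is, the $V_i$ are isometries on $\mathcal H$ with $$V_i^*V_j=U_{ij}^*V_jV_i^*\quad\text{and}\quad V_kU_{ij}=U_{ij}V_k\qquad(i,j,k\in I_n,\ i\ne j).$$ For $A\subseteq I_n$ let $\mathcal W_A=\bigcap_{i\in A}\ker V_i^*$ (with $\mathcal W_\emptyset=\mathcal H$), and, writing $I_n\setminus A=\{q_1<\dots<q_{n-|A|}\}$, let $$\mathcal D_A=\bigcap_{l\in\mathbb Z_+^{n-|A|}}V_{q_1}^{l_1}\cdots V_{q_{n-|A|}}^{l_{n-|A|}}\,\mathcal W_A$$ be the $A$-wandering subspace (so $\mathcal D_{I_n}=\mathcal W_{I_n}$). It is a closed subspace, invariant under $V_j$ for $j\notin A$, and it reduces every $U_{st}$, $s\neq t$. For a Hilbert space $\mathcal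 E$ let $H^2_{\mathcal E}(\mathbb D^m)$ be the Hardy space of functions $f(z)=\sum_{k\in\mathbb Z_+^m}z^ka_k$ on $\mathbb D^m$ with $a_k\in\mathcal E$ and $\|f\|^2=\sum_k\|a_k\|^2<\infty$ (for $m=0$ this is $\mathcal E$). Let $M_{z_i}$ be multiplication by $z_i$; for a unitary $U$ on $\mathcal E$ let $D_j[U]$ be the unitary operator on $H^2_{\mathcal E}(\mathbb D^m)$ with $D_j[U](z^k\eta)=z^kU^{k_j}\eta$; and for a bounded operator $T$ on $\mathcal E$ let $I\otimes T$ be the operator with $(I\otimes T)(z^k\eta)=z^k\,T\eta$. For $A=\{p_1<\dots<p_m\}\subseteq I_n$ and $t\in I_n$ define $M_{A,t}$ on $H^2_{\mathcal D_A}(\mathbb D^{m})$ by $$M_{A,t}=\begin{cases}M_{z_i}\,D_1[U_{p_ip_1}|_{\mathcal D_A}]\cdots D_{i-1}[U_{p_ip_{i-1}}|_{\mathcal D_A}] & \text{if } t=p_i\in A \quad(\text{so } M_{A,p_1}=M_{z_1}),\\[2pt] D_1[U_{tp_1}|_{\mathcal D_A}]\cdots D_m[U_{tp_m}|_{\mathcal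 D_A}]\,(I\otimes V_t|_{\mathcal D_A}) & \text{if } t\notin A,\end{cases}$$ and let $M_{V,t}=\bigoplus_{A\subseteq I_n}M_{A,t}$ on $\bigoplus_{A\subseteq I_n}H^2_{\mathcal D_A}(\mathbb D^{|A|})$. Then $(V_1,\dots,V_n)$ is unitarily equivalent to $(M_{V,1},\dots,M_{V,n})$: there is a unitary $\Pi:\mathcal H\to\bigoplus_{A\subseteq I_n}H^2_{\mathcal D_A}(\mathbb D^{|A|})$ with $\Pi V_t=M_{V,t}\Pi$ for all $t\in I_n$. -/

import Mathlib

noncomputable section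

namespace TwistedIsometries

/-! ### The vector-valued Hardy space over the polydisc -/

/-- The open unit polydisc `𝔻^m`. -/
def Polydisc (m : ℕ) : Type := {z : Fin m → ℂ // ∀ i, ‖z i‖ < 1}

/-- The monomial `z^k = z_1^{k_1} ⋯ z_m^{k_m}` on the polydisc. -/
def monomial {m : ℕ} (k : Fin m → ℕ) (z : Polydisc m) : ℂ := ∏ i, z.1 i ^ k i

lemma norm_monomial_le_one {m : ℕ} (k : Fin m → ℕ) (z : Polydisc m) : ‖monomial k z‖ ≤ 1 := by
  rw [monomial, norm_prod]
  refine Finset.prod_le_one (fun i _ => norm_nonneg _) (fun i _ => ?_)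
  rw [norm_pow]
  exact pow_le_one₀ (norm_nonneg _) (z.2 i).le

lemma summable_monomial {m : ℕ} (z : Polydisc m) : Summable fun k => ‖monomial k z‖ := by
  refine summable_of_sum_le (c := ∏ i, (1 - ‖z.1 i‖)⁻¹) (fun k => norm_nonneg _) (fun s => ?_)
  let N : ℕ := s.sup (fun k => ∑ i, k i) + 1
  have hs : s ⊆ Fintype.piFinset (fun _ : Fin m => Finset.range N) := by
    intro k hk
    rw [Fintype.mem_piFinset]
    intro i
    rw [Finset.mem_range, Nat.lt_succ_iff]
    exact (Finset.single_le_sum (fun j _ => Nat.zero_le (k j)) (Finset.mem_univ i)).trans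
      (Finset.le_sup (f := fun k : Fin m → ℕ => ∑ i, k i) hk)
  calc ∑ k ∈ s, ‖monomial k z‖
      ≤ ∑ k ∈ Fintype.piFinset (fun _ : Fin m => Finset.range N), ‖monomial k z‖ :=
        Finset.sum_le_sum_of_subset_of_nonneg hs (fun _ _ _ => norm_nonneg _)
    _ = ∏ i, ∑ j ∈ Finset.range N, ‖z.1 i‖ ^ j := by
        rw [Finset.prod_univ_sum]
        simp [monomial, norm_prod, norm_pow]
    _ ≤ ∏ i, (1 - ‖z.1 i‖)⁻¹ := by
        refine Finset.prod_le_prod (fun i _ => Finset.sum_nonneg fun j _ => by positivity)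
          (fun i _ => ?_)
        rw [← tsum_geometric_of_lt_one (norm_nonneg _) (z.2 i)]
        exact (summable_geometric_of_lt_one (norm_nonneg _) (z.2 i)).sum_le_tsum _
          (fun j _ => by positivity)

/-- Uniqueness of the coefficients of a vector-valued power series in one variable. -/
lemma coeff_eq_zero_one {E : Type*} [NormedAddCommGroup E] [NormedSpace ℂ E]
    (c : ℕ → E) (h : ∀ z : ℂ, ‖z‖ < 1 → HasSum (fun n => z ^ n • c n) 0) (n : ℕ) : c n = 0 := by
  let p : FormalMultilinearSeries ℂ ℂ E := fun n =>
    ContinuousMultilinearMap.mkPiRing ℂ (Fin n) (c n)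
  have hp : HasFPowerSeriesOnBall (fun _ => (0 : E)) p 0 (1 / 2 : NNReal) := by
    refine ⟨?_, by norm_num, ?_⟩
    · refine p.le_radius_of_tendsto (l := 0) ?_
      have := (h (1 / 2) (by norm_num)).summable.tendsto_atTop_zero.norm
      simpa [p, norm_smul, mul_comm] using this
    · intro y hy
      have hy' : ‖y‖ < 1 := by
        rw [Metric.eball_coe, mem_ball_zero_iff] at hy
        refine hy.trans ?_
        norm_num
      simpa [p] using h y hy'
  have h0 := hp.hasFPowerSeriesAt.eq_zero
  have h1 : p n = 0 := by rw [h0]; rfl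
  have h2 : p n (fun _ => 1) = 0 := by rw [h1]; rfl
  simpa [p] using h2

/-- Uniqueness of the coefficients of a vector-valued power series on the polydisc. -/
lemma coeff_eq_zero {E : Type*} [NormedAddCommGroup E] [NormedSpace ℂ E] [CompleteSpace E]
    (m : ℕ) : ∀ a : (Fin m → ℕ) → E,
    (∀ z : Polydisc m, HasSum (fun k => monomial k z • a k) 0) → ∀ k, a k = 0 := by
  induction m with
  | zero =>
    intro a h k
    have h1 := h ⟨fun i => i.elim0, fun i => i.elim0⟩
    have h2 := hasSum_unique (fun k : Fin 0 → ℕ => monomial k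
      (⟨fun i => i.elim0, fun i => i.elim0⟩ : Polydisc 0) • a k)
    have h3 := h1.unique h2
    simp only [monomial, Finset.univ_eq_empty, Finset.prod_empty, one_smul] at h3
    exact (congrArg a (Subsingleton.elim _ _)).trans h3.symm
  | succ m ih =>
    intro a h k
    have key : ∀ (w : Polydisc m) (n : ℕ),
        HasSum (fun k' : Fin m → ℕ => monomial k' w • a (Fin.cons n k')) 0 := by
      intro w
      have hz : ∀ ζ : ℂ, ‖ζ‖ < 1 → HasSum (fun q : ℕ × (Fin m → ℕ) =>
          ζ ^ q.1 • (monomial q.2 w • a (Fin.cons q.1 q.2))) 0 := by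
        intro ζ hζ
        have h1 := h ⟨Fin.cons ζ w.1, fun i => by
          refine Fin.cases ?_ (fun j => ?_) i
          · simpa using hζ
          · simpa using w.2 j⟩
        rw [← (Fin.consEquiv (fun _ : Fin (m + 1) => ℕ)).hasSum_iff] at h1
        convert h1 using 2 with q
        simp [monomial, Fin.prod_univ_succ, smul_smul, Fin.consEquiv]
      have hs : ∀ n, Summable fun k' : Fin m → ℕ => monomial k' w • a (Fin.cons n k') := by
        intro n
        have h2 := (hz (1 / 2) (by norm_num)).summable.prod_factor n
        have h3 := h2.const_smul ((1 / 2 : ℂ) ^ n)⁻¹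
        refine h3.congr (fun k' => ?_)
        rw [smul_smul, inv_mul_cancel₀ (pow_ne_zero _ (by norm_num)), one_smul]
      have hc := coeff_eq_zero_one (fun n => ∑' k' : Fin m → ℕ, monomial k' w • a (Fin.cons n k'))
        (fun ζ hζ => (hz ζ hζ).prod_fiberwise fun n => (hs n).hasSum.const_smul (ζ ^ n))
      intro n
      have := (hs n).hasSum
      rwa [hc n] at this
    rw [← Fin.cons_self_tail k]
    exact ih _ (fun w => key w (k 0)) (Fin.tail k)

/-- `ℓ²(ℤ₊^m; E)`: square summable coefficient families. -/
abbrev Coeff (m : ℕ) (E : Type*) [NormedAddCommGroup E] : Type _ :=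
  lp (fun _ : Fin m → ℕ => E) 2

variable {m : ℕ} {E : Type*} [NormedAddCommGroup E] [InnerProductSpace ℂ E] [CompleteSpace E]

lemma summable_coeff (a : Coeff m E) (z : Polydisc m) :
    Summable fun k => monomial k z • a k := by
  refine Summable.of_norm_bounded ((summable_monomial z).mul_right ‖a‖) (fun k => ?_)
  rw [norm_smul]
  exact mul_le_mul_of_nonneg_left (lp.norm_apply_le_norm (by norm_num) a k) (norm_nonneg _)

/-- The linear space underlying the Hardy space `H²_E(𝔻^m)`: the functions `f : 𝔻^m → E` of the
form `f(z) = ∑_k z^k a_k` with `∑_k ‖a_k‖² < ∞`. -/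
def hardySubmodule (m : ℕ) (E : Type*) [NormedAddCommGroup E] [InnerProductSpace ℂ E] :
    Submodule ℂ (Polydisc m → E) where
  carrier := {f | ∃ a : Coeff m E, ∀ z, HasSum (fun k => monomial k z • a k) (f z)}
  zero_mem' := ⟨0, fun z => by simp [hasSum_zero]⟩
  add_mem' := by
    rintro f g ⟨a, ha⟩ ⟨b, hb⟩
    exact ⟨a + b, fun z => by simpa [smul_add] using (ha z).add (hb z)⟩
  smul_mem' := by
    rintro c f ⟨a, ha⟩
    exact ⟨c • a, fun z => by simpa [smul_comm c] using (ha z).const_smul c⟩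

/-- The `E`-valued Hardy space `H²_E(𝔻^m)`, as a space of functions on the polydisc. -/
def Hardy (m : ℕ) (E : Type*) [NormedAddCommGroup E] [InnerProductSpace ℂ E] : Type _ :=
  hardySubmodule m E

namespace Hardy

instance : AddCommGroup (Hardy m E) := inferInstanceAs (AddCommGroup (hardySubmodule m E))

instance : Module ℂ (Hardy m E) := inferInstanceAs (Module ℂ (hardySubmodule m E))

instance : CoeFun (Hardy m E) (fun _ => Polydisc m → E) := ⟨fun f => f.1⟩

/-- The element `z ↦ ∑_k z^k a_k` of the Hardy space with given Taylor coefficients `a_k`. -/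
def ofCoeffLin (m : ℕ) (E : Type*) [NormedAddCommGroup E] [InnerProductSpace ℂ E]
    [CompleteSpace E] : Coeff m E →ₗ[ℂ] Hardy m E where
  toFun a := ⟨fun z => ∑' k, monomial k z • a k, a, fun z => (summable_coeff a z).hasSum⟩
  map_add' a b := Subtype.ext <| funext fun z => by
    change ∑' k, monomial k z • (a + b) k
      = ∑' k, monomial k z • a k + ∑' k, monomial k z • b k
    rw [← (summable_coeff a z).tsum_add (summable_coeff b z)]
    simp [smul_add]
  map_smul' c a := Subtype.ext <| funext fun z => by
    change ∑' k, monomial k z • (c • a) k = c • ∑' k, monomial k z • a k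
    rw [← (summable_coeff a z).tsum_const_smul c]
    simp [smul_comm c]

lemma ofCoeffLin_bijective : Function.Bijective (ofCoeffLin m E) := by
  constructor
  · rw [← LinearMap.ker_eq_bot, LinearMap.ker_eq_bot']
    intro a ha
    refine lp.ext (funext fun k => ?_)
    refine coeff_eq_zero m a (fun z => ?_) k
    have h1 := (summable_coeff a z).hasSum
    have h2 : ∑' k, monomial k z • a k = 0 := congrFun (congrArg Subtype.val ha) z
    rwa [h2] at h1
  · rintro ⟨f, a, ha⟩
    exact ⟨a, Subtype.ext <| funext fun z => (ha z).tsum_eq⟩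

/-- A function in the Hardy space corresponds to the family of its Taylor coefficients. -/
def coeffLin (m : ℕ) (E : Type*) [NormedAddCommGroup E] [InnerProductSpace ℂ E]
    [CompleteSpace E] : Hardy m E ≃ₗ[ℂ] Coeff m E :=
  (LinearEquiv.ofBijective (ofCoeffLin m E) ofCoeffLin_bijective).symm

/-- The norm `‖f‖ = (∑_k ‖a_k‖²)^{1/2}`. -/
instance : NormedAddCommGroup (Hardy m E) :=
  NormedAddCommGroup.induced (Hardy m E) (Coeff m E) (coeffLin m E).toLinearMap
    (coeffLin m E).injective

instance : NormedSpace ℂ (Hardy m E) :=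
  NormedSpace.induced ℂ (Hardy m E) (Coeff m E) (coeffLin m E).toLinearMap

/-- The inner product `⟪f, g⟫ = ∑_k ⟪a_k, b_k⟫`. -/
instance : InnerProductSpace ℂ (Hardy m E) where
  inner f g := inner ℂ (coeffLin m E f) (coeffLin m E g)
  norm_sq_eq_re_inner f := norm_sq_eq_re_inner (𝕜 := ℂ) (coeffLin m E f)
  conj_inner_symm f g := inner_conj_symm (𝕜 := ℂ) (coeffLin m E f) (coeffLin m E g)
  add_left f g h := by
    rw [map_add]
    exact inner_add_left _ _ _
  smul_left f g c := by
    rw [map_smul]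
    exact inner_smul_left _ _ _

/-- The Taylor coefficients, as a unitary map onto `ℓ²(ℤ₊^m; E)`. -/
def coeff (m : ℕ) (E : Type*) [NormedAddCommGroup E] [InnerProductSpace ℂ E]
    [CompleteSpace E] : Hardy m E ≃ₗᵢ[ℂ] Coeff m E where
  toLinearEquiv := coeffLin m E
  norm_map' _ := rfl

instance : CompleteSpace (Hardy m E) :=
  (coeff m E).isometry.isUniformInducing.completeSpace_congr (coeff m E).surjective |>.2
    inferInstance

lemma hasSum_coeff (f : Hardy m E) (z : Polydisc m) :
    HasSum (fun k => monomial k z • coeff m E f k) (f z) := by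
  have h1 := (summable_coeff (coeff m E f) z).hasSum
  have h2 : ofCoeffLin m E (coeff m E f) = f :=
    (LinearEquiv.ofBijective (ofCoeffLin m E) ofCoeffLin_bijective).apply_symm_apply f
  have h3 : ∑' k, monomial k z • coeff m E f k = f z := congrFun (congrArg Subtype.val h2) z
  rwa [h3] at h1

lemma coeff_eq_of_hasSum (f : Hardy m E) (a : Coeff m E)
    (h : ∀ z, HasSum (fun k => monomial k z • a k) (f z)) : coeff m E f = a := by
  refine (LinearEquiv.symm_apply_eq _).2 (Subtype.ext <| funext fun z => ?_)
  exact (h z).tsum_eq.symm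

/-- The index shift `k ↦ k + e_i`. -/
def shiftIndex (i : Fin m) (k : Fin m → ℕ) : Fin m → ℕ := k + Pi.single i 1

lemma shiftIndex_injective (i : Fin m) : Function.Injective (shiftIndex i) :=
  add_left_injective _

lemma monomial_shiftIndex (i : Fin m) (k : Fin m → ℕ) (z : Polydisc m) :
    monomial (shiftIndex i k) z = z.1 i * monomial k z := by
  simp only [monomial, shiftIndex, Pi.add_apply, pow_add, Finset.prod_mul_distrib]
  rw [mul_comm]
  congr 1
  rw [Finset.prod_eq_single i (fun j _ hj => by simp [hj]) (by simp)]
  simp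

/-- The coefficients of `z_i f` in terms of those of `f`. -/
def shiftCoeff (i : Fin m) (a : Coeff m E) : Coeff m E :=
  ⟨Function.extend (shiftIndex i) a 0, by
    have h := (lp.memℓp a).summable (by norm_num)
    refine memℓp_gen ?_
    rw [← (shiftIndex_injective i).summable_iff]
    · simpa [Function.comp_def, (shiftIndex_injective i).extend_apply] using h
    · intro k hk
      rw [Function.extend_apply' _ _ _ (by simpa using hk)]
      simp⟩

set_option linter.unusedSectionVars false in
lemma norm_shiftCoeff (i : Fin m) (a : Coeff m E) : ‖shiftCoeff i a‖ = ‖a‖ := by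
  rw [lp.norm_eq_tsum_rpow (by norm_num), lp.norm_eq_tsum_rpow (by norm_num)]
  congr 1
  rw [← (shiftIndex_injective i).tsum_eq]
  · simp [shiftCoeff, (shiftIndex_injective i).extend_apply]
  · intro k hk
    by_contra h
    apply hk
    simp only [shiftCoeff]
    rw [Function.extend_apply' _ _ _ (by simpa using h)]
    simp

lemma hasSum_shiftCoeff (i : Fin m) (f : Hardy m E) (z : Polydisc m) :
    HasSum (fun k => monomial k z • shiftCoeff i (coeff m E f) k) (z.1 i • f z) := by
  rw [← (shiftIndex_injective i).hasSum_iff]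
  · simpa [Function.comp_def, shiftCoeff, (shiftIndex_injective i).extend_apply,
      monomial_shiftIndex, smul_smul] using (hasSum_coeff f z).const_smul (z.1 i)
  · intro k hk
    simp only [shiftCoeff]
    rw [Function.extend_apply' _ _ _ (by simpa using hk)]
    simp

/-- The multiplication operator `M_{z_i}` on `H²_E(𝔻^m)`: `(M_{z_i} f)(z) = z_i f(z)`. -/
def mulCoord (i : Fin m) : Hardy m E →L[ℂ] Hardy m E :=
  LinearMap.mkContinuous
    { toFun := fun f => ⟨fun z => z.1 i • f z, shiftCoeff i (coeff m E f), hasSum_shiftCoeff i f⟩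
      map_add' := fun f g => Subtype.ext <| funext fun z => smul_add (z.1 i) (f z) (g z)
      map_smul' := fun c f => Subtype.ext <| funext fun z => smul_comm (z.1 i) c (f z) }
    1 (fun f => by
      rw [one_mul, ← (coeff m E).norm_map f, ← norm_shiftCoeff i, ← (coeff m E).norm_map,
        coeff_eq_of_hasSum _ (shiftCoeff i (coeff m E f)) (hasSum_shiftCoeff i f)])

/-- The `j`-th diagonal operator with symbol `U`: `D_j[U] (∑_k z^k a_k) = ∑_k z^k U^{k_j} a_k`. -/
def diagOp (j : Fin m) (U : unitary (E →L[ℂ] E)) : Hardy m E →L[ℂ] Hardy m E :=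
  (coeff m E).symm.toContinuousLinearEquiv.toContinuousLinearMap ∘L
    lp.mapCLM 2 (fun k : Fin m → ℕ => (U : E →L[ℂ] E) ^ k j) zero_le_one
      (fun k => ContinuousLinearMap.opNorm_le_bound _ zero_le_one (fun x => by
        rw [one_mul, ContinuousLinearMap.norm_map_of_mem_unitary (pow_mem U.2 (k j))])) ∘L
    (coeff m E).toContinuousLinearEquiv.toContinuousLinearMap

lemma coeff_diagOp (j : Fin m) (U : unitary (E →L[ℂ] E)) (f : Hardy m E) (k : Fin m → ℕ) :
    coeff m E (diagOp j U f) k = ((U : E →L[ℂ] E) ^ k j) (coeff m E f k) := by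
  simp [diagOp]

/-- The operator `I_{H²(𝔻^m)} ⊗ T` on `H²_E(𝔻^m) = H²(𝔻^m) ⊗ E`, that is,
`∑_k z^k a_k ↦ ∑_k z^k T a_k`. -/
def idTensor (m : ℕ) (T : E →L[ℂ] E) : Hardy m E →L[ℂ] Hardy m E :=
  (coeff m E).symm.toContinuousLinearEquiv.toContinuousLinearMap ∘L
    lp.mapCLM 2 (fun _ : Fin m → ℕ => T) (norm_nonneg T) (fun _ => le_rfl) ∘L
    (coeff m E).toContinuousLinearEquiv.toContinuousLinearMap

lemma coeff_idTensor (T : E →L[ℂ] E) (f : Hardy m E) (k : Fin m → ℕ) :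
    coeff m E (idTensor m T f) k = T (coeff m E f k) := by
  simp [idTensor]

end Hardy


/-! ### Twisted isometries -/

/-- The extension of a family of unitaries `U_{ij}`, `i < j`, by `U_{ji} := U_{ij}^*`. (The diagonal
value `1` is a placeholder that is never used.) -/
def twist {n : ℕ} {H : Type*} [NormedAddCommGroup H] [InnerProductSpace ℂ H] [CompleteSpace H]
    (U : ∀ i j : Fin n, i < j → unitary (H →L[ℂ] H)) (i j : Fin n) : unitary (H →L[ℂ] H) :=
  if h : i < j then U i j h else if h : j < i then star (U j i h) else 1

/-- A `𝒰_n`-twisted isometry on `H`: isometries `V_1, …, V_n` and commuting unitaries `U_{ij}`,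
`i < j`, such that `V_i^* V_j = U_{ij}^* V_j V_i^*` and `V_k U_{ij} = U_{ij} V_k` for all `i, j, k`
with `i ≠ j`, where `U_{ji} := U_{ij}^*` for `i < j`. -/
structure TwistedIsometry (n : ℕ) (H : Type*) [NormedAddCommGroup H] [InnerProductSpace ℂ H]
    [CompleteSpace H] where
  /-- The isometries `V_i`. -/
  V : Fin n → H →L[ℂ] H
  /-- The unitaries `U_{ij}`, `i < j`. -/
  U : ∀ i j : Fin n, i < j → unitary (H →L[ℂ] H)
  isometry : ∀ i, star (V i) * V i = 1
  commute : ∀ i j (hij : i < j) s t (hst : s < t), Commute (U i j hij) (U s t hst)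
  twisted : ∀ i j, i ≠ j →
    star (V i) * V j = star (twist U i j : H →L[ℂ] H) * V j * star (V i)
  commute_twist : ∀ k i j, i ≠ j →
    V k * (twist U i j : H →L[ℂ] H) = (twist U i j : H →L[ℂ] H) * V k

/-- Unitary equivalence of two `n`-tuples of operators. -/
def UnitarilyEquivalent {n : ℕ} {H K : Type*} [NormedAddCommGroup H] [InnerProductSpace ℂ H]
    [NormedAddCommGroup K] [InnerProductSpace ℂ K]
    (V : Fin n → H →L[ℂ] H) (W : Fin n → K →L[ℂ] K) : Prop :=
  ∃ Φ : H ≃ₗᵢ[ℂ] K, ∀ i x, Φ (V i x) = W i (Φ x)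

/-- For `B = {q_1 < ⋯ < q_r}` and `l ∈ ℤ₊^r`, the operator `V_B^l = V_{q_1}^{l_1} ⋯ V_{q_r}^{l_r}`
(the identity if `B` is empty). -/
def tuplePow {n : ℕ} {H : Type*} [NormedAddCommGroup H] [InnerProductSpace ℂ H]
    (V : Fin n → H →L[ℂ] H) (B : Finset (Fin n)) (l : Fin B.card → ℕ) : H →L[ℂ] H :=
  (List.ofFn fun j => V (B.orderEmbOfFin rfl j) ^ l j).prod

/-- `𝒲_A = ⋂_{i ∈ A} ker V_i^*` (the whole space if `A` is empty). -/
def kerAdjoint {n : ℕ} {H : Type*} [NormedAddCommGroup H] [InnerProductSpace ℂ H] [CompleteSpace H]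
    (V : Fin n → H →L[ℂ] H) (A : Finset (Fin n)) : Submodule ℂ H :=
  ⨅ i ∈ A, (star (V i)).ker

/-- The `A`-wandering subspace `𝒟_A = ⋂_l V_{A^c}^l 𝒲_A`, `l` ranging over `ℤ₊^{n - |A|}`. -/
def wanderingSubspace {n : ℕ} {H : Type*} [NormedAddCommGroup H] [InnerProductSpace ℂ H]
    [CompleteSpace H] (V : Fin n → H →L[ℂ] H) (A : Finset (Fin n)) : Submodule ℂ H :=
  ⨅ l : Fin Aᶜ.card → ℕ, (kerAdjoint V A).map (tuplePow V Aᶜ l).toLinearMap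

namespace TwistedIsometry

variable {n : ℕ} {H : Type*} [NormedAddCommGroup H] [InnerProductSpace ℂ H] [CompleteSpace H]
  (T : TwistedIsometry n H)

/-- `𝒟_A` for the tuple `V`. -/
abbrev D (A : Finset (Fin n)) : Submodule ℂ H := wanderingSubspace T.V A

/-- The unitary `U_{ij}`, `i ≠ j`, where `U_{ji} = U_{ij}^*`. -/
abbrev u (i j : Fin n) : unitary (H →L[ℂ] H) := twist T.U i j

lemma mem_kerAdjoint {V : Fin n → H →L[ℂ] H} {A : Finset (Fin n)} {x : H} :
    x ∈ kerAdjoint V A ↔ ∀ i ∈ A, star (V i) x = 0 := by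
  simp [kerAdjoint, Submodule.mem_iInf]

lemma isClosed_kerAdjoint (V : Fin n → H →L[ℂ] H) (A : Finset (Fin n)) :
    IsClosed (kerAdjoint V A : Set H) := by
  have : (kerAdjoint V A : Set H) = ⋂ i ∈ A, {x | star (V i) x = 0} := by
    ext x
    simp [mem_kerAdjoint]
  rw [this]
  exact isClosed_biInter fun i _ => isClosed_eq (star (V i)).continuous continuous_const

lemma star_mul_self_list (L : List (H →L[ℂ] H)) (hL : ∀ X ∈ L, star X * X = 1) :
    star L.prod * L.prod = 1 := by
  induction L with
  | nil => simp
  | cons X L ih =>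
    rw [List.prod_cons, star_mul, mul_assoc, ← mul_assoc (star X), hL X (by simp), one_mul]
    exact ih fun Y hY => hL Y (by simp [hY])

lemma star_mul_self_pow (X : H →L[ℂ] H) (hX : star X * X = 1) (r : ℕ) :
    star (X ^ r) * X ^ r = 1 := by
  rw [← List.prod_replicate]
  exact star_mul_self_list _ fun Y hY => by rwa [List.eq_of_mem_replicate hY]

lemma isometry_tuplePow (B : Finset (Fin n)) (l : Fin B.card → ℕ) :
    Isometry (tuplePow T.V B l) := by
  rw [ContinuousLinearMap.isometry_iff_adjoint_comp_self]
  refine star_mul_self_list _ fun X hX => ?_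
  obtain ⟨j, rfl⟩ := (List.mem_ofFn' _ _).1 hX
  exact star_mul_self_pow _ (T.isometry _) _

lemma isClosed_D (A : Finset (Fin n)) : IsClosed (T.D A : Set H) := by
  have : (T.D A : Set H)
      = ⋂ l : Fin Aᶜ.card → ℕ, tuplePow T.V Aᶜ l '' (kerAdjoint T.V A : Set H) := by
    ext x
    simp [D, wanderingSubspace]
  rw [this]
  exact isClosed_iInter fun l =>
    (T.isometry_tuplePow Aᶜ l).isClosedEmbedding.isClosedMap _ (isClosed_kerAdjoint _ _)

instance (A : Finset (Fin n)) : CompleteSpace (T.D A) := (T.isClosed_D A).completeSpace_coe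

/-- An operator is *central* for `V` if it commutes with all `V_k` and `V_k^*`. -/
def IsCentral (X : H →L[ℂ] H) : Prop :=
  ∀ k, T.V k * X = X * T.V k ∧ star (T.V k) * X = X * star (T.V k)

lemma isCentral_u {i j : Fin n} (h : i ≠ j) : T.IsCentral (T.u i j : H →L[ℂ] H) := by
  intro k
  refine ⟨T.commute_twist k i j h, ?_⟩
  have h1 := congrArg star (T.commute_twist k i j h)
  rw [star_mul, star_mul] at h1
  have hu := Unitary.mul_star_self_of_mem (T.u i j).2
  have hu' := Unitary.star_mul_self_of_mem (T.u i j).2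
  calc star (T.V k) * (T.u i j : H →L[ℂ] H)
      = (T.u i j * star (T.u i j : H →L[ℂ] H)) * star (T.V k) * (T.u i j : H →L[ℂ] H) := by
        rw [hu, one_mul]
    _ = (T.u i j : H →L[ℂ] H) * (star (T.V k) * (star (T.u i j : H →L[ℂ] H) * T.u i j)) := by
        rw [mul_assoc (T.u i j : H →L[ℂ] H), h1]
        simp only [mul_assoc]
    _ = (T.u i j : H →L[ℂ] H) * star (T.V k) := by rw [hu', mul_one]

variable {T} in
lemma IsCentral.star_mem {X : H →L[ℂ] H} (hX : T.IsCentral X) : T.IsCentral (star X) := by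
  intro k
  have h1 := congrArg star (hX k).1
  have h2 := congrArg star (hX k).2
  simp only [star_mul, star_star] at h1 h2
  exact ⟨h2.symm, h1.symm⟩

variable {T} in
lemma IsCentral.pow {X : H →L[ℂ] H} (hX : T.IsCentral X) (r : ℕ) : T.IsCentral (X ^ r) := by
  intro k
  exact ⟨Commute.pow_right (hX k).1 r, Commute.pow_right (hX k).2 r⟩

variable {T} in
lemma IsCentral.mul {X Y : H →L[ℂ] H} (hX : T.IsCentral X) (hY : T.IsCentral Y) :
    T.IsCentral (X * Y) := by
  intro k
  exact ⟨Commute.mul_right (hX k).1 (hY k).1, Commute.mul_right (hX k).2 (hY k).2⟩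

lemma isCentral_one : T.IsCentral 1 := fun k => ⟨by simp, by simp⟩

variable {T} in
lemma IsCentral.commute_tuplePow {X : H →L[ℂ] H} (hX : T.IsCentral X) (B : Finset (Fin n))
    (l : Fin B.card → ℕ) : Commute X (tuplePow T.V B l) := by
  refine Commute.list_prod_right _ _ fun Y hY => ?_
  obtain ⟨j, rfl⟩ := (List.mem_ofFn' _ _).1 hY
  exact Commute.pow_right (hX _).1.symm _

variable {T} in
lemma IsCentral.kerAdjoint_mem {X : H →L[ℂ] H} (hX : T.IsCentral X) {A : Finset (Fin n)} {x : H}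
    (hx : x ∈ kerAdjoint T.V A) : X x ∈ kerAdjoint T.V A := by
  rw [mem_kerAdjoint] at hx ⊢
  intro i hi
  have := DFunLike.congr_fun (hX i).2 x
  simpa [hx i hi] using this

variable {T} in
lemma IsCentral.D_mem {X : H →L[ℂ] H} (hX : T.IsCentral X) {A : Finset (Fin n)} {x : H}
    (hx : x ∈ T.D A) : X x ∈ T.D A := by
  rw [D, wanderingSubspace, Submodule.mem_iInf] at hx ⊢
  intro l
  obtain ⟨w, hw, rfl⟩ := hx l
  exact ⟨X w, hX.kerAdjoint_mem hw, (DFunLike.congr_fun (hX.commute_tuplePow Aᶜ l) w).symm⟩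

lemma u_swap {i j : Fin n} (h : i ≠ j) : T.u j i = star (T.u i j) := by
  rcases lt_or_gt_of_ne h with h | h
  · simp [u, twist, h, not_lt_of_gt h]
  · simp [u, twist, h, not_lt_of_gt h]

/-- `V_i V_j = U_{ij} V_j V_i` for `i ≠ j`. -/
lemma V_mul_V {i j : Fin n} (h : i ≠ j) :
    T.V i * T.V j = (T.u i j : H →L[ℂ] H) * T.V j * T.V i := by
  have hc := T.isCentral_u h
  have hc' := hc.star_mem
  have h1 := T.twisted i j h
  have h2 := T.twisted j i h.symm
  change star (T.V j) * T.V i = star (T.u j i : H →L[ℂ] H) * T.V i * star (T.V j) at h2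
  rw [T.u_swap h, Unitary.coe_star, star_star] at h2
  change star (T.V i) * T.V j = star (T.u i j : H →L[ℂ] H) * T.V j * star (T.V i) at h1
  have hu := Unitary.mul_star_self_of_mem (T.u i j).2
  have hu' := Unitary.star_mul_self_of_mem (T.u i j).2
  have ha := T.isometry i
  have hb := T.isometry j
  obtain ⟨c1, c2⟩ := hc j
  obtain ⟨c1', c2'⟩ := hc' j
  obtain ⟨d1, d2⟩ := hc i
  obtain ⟨d1', d2'⟩ := hc' i
  generalize (T.u i j : H →L[ℂ] H) = c at *
  generalize T.V i = a at *
  generalize T.V j = b at *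
  have e1 : star b * star a * (c * b * a) = 1 := by
    calc star b * star a * (c * b * a) = star b * (star a * c) * b * a := by noncomm_ring
      _ = (star b * c) * (star a * b) * a := by rw [d2]; noncomm_ring
      _ = c * (star b * star c) * b * (star a * a) := by rw [c2, h1]; noncomm_ring
      _ = (c * star c) * (star b * b) * (star a * a) := by rw [c2']; noncomm_ring
      _ = 1 := by rw [hu, ha, hb]; simp
  have e2 : star a * star b * star c * (a * b) = 1 := by
    have := congrArg star e1
    simpa only [star_mul, star_star, star_one, mul_assoc] using this
  have e3 : star b * star a * (a * b) = 1 := by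
    calc star b * star a * (a * b) = star b * (star a * a) * b := by noncomm_ring
      _ = 1 := by rw [ha, mul_one, hb]
  have e4 : star a * star b * star c * (c * b * a) = 1 := by
    calc star a * star b * star c * (c * b * a)
        = star a * (star b * (star c * c) * b) * a := by noncomm_ring
      _ = 1 := by rw [hu', mul_one, hb, mul_one, ha]
  have e5 : star (a * b - c * b * a) * (a * b - c * b * a) = 0 := by
    have : star (a * b - c * b * a) = star b * star a - star a * star b * star c := by
      simp only [star_sub, star_mul, mul_assoc]
    rw [this, sub_mul, mul_sub, mul_sub, e1, e2, e3, e4]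
    simp
  exact sub_eq_zero.1 (CStarRing.star_mul_self_eq_zero_iff _ |>.1 e5)

lemma exists_V_mul_tuplePow (j : Fin n) (B : Finset (Fin n)) (l : Fin B.card → ℕ) :
    ∃ X, T.IsCentral X ∧ T.V j * tuplePow T.V B l = tuplePow T.V B l * (T.V j * X) := by
  have h1 : ∀ q, ∃ X, T.IsCentral X ∧ T.V j * T.V q = T.V q * (T.V j * X) := by
    intro q
    by_cases h : j = q
    · subst h
      exact ⟨1, T.isCentral_one, by simp⟩
    · refine ⟨_, T.isCentral_u h, ?_⟩
      have h1 := (T.isCentral_u h j).1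
      have h2 := (T.isCentral_u h q).1
      rw [T.V_mul_V h, h1, ← mul_assoc, h2]
  have h2 : ∀ q r, ∃ X, T.IsCentral X ∧ T.V j * T.V q ^ r = T.V q ^ r * (T.V j * X) := by
    intro q r
    obtain ⟨X, hX, h⟩ := h1 q
    refine ⟨X ^ r, hX.pow r, ?_⟩
    induction r with
    | zero => simp
    | succ r ih =>
      have hc : Commute (T.V q) (X ^ r) := ((hX.pow r) q).1
      calc T.V j * T.V q ^ (r + 1) = (T.V j * T.V q ^ r) * T.V q := by rw [pow_succ, mul_assoc]
        _ = T.V q ^ r * T.V j * (X ^ r * T.V q) := by rw [ih]; simp only [mul_assoc]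
        _ = T.V q ^ r * (T.V j * T.V q) * X ^ r := by rw [← hc.eq]; simp only [mul_assoc]
        _ = T.V q ^ (r + 1) * (T.V j * X ^ (r + 1)) := by
          rw [h, pow_succ, pow_succ' X]; simp only [mul_assoc]
  have h3 : ∀ L : List (H →L[ℂ] H), (∀ Y ∈ L, ∃ q r, Y = T.V q ^ r) →
      ∃ X, T.IsCentral X ∧ T.V j * L.prod = L.prod * (T.V j * X) := by
    intro L
    induction L with
    | nil => exact fun _ => ⟨1, T.isCentral_one, by simp⟩
    | cons Y L ih =>
      intro hL
      obtain ⟨X, hX, h⟩ := ih fun Z hZ => hL Z (by simp [hZ])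
      obtain ⟨q, r, rfl⟩ := hL Y (by simp)
      obtain ⟨X', hX', h'⟩ := h2 q r
      have hc : Commute X' L.prod := by
        refine Commute.list_prod_right _ _ fun Z hZ => ?_
        obtain ⟨q', r', rfl⟩ := hL Z (by simp [hZ])
        exact Commute.pow_right (hX' q').1.symm r'
      refine ⟨X * X', hX.mul hX', ?_⟩
      calc T.V j * (T.V q ^ r :: L).prod = (T.V j * T.V q ^ r) * L.prod := by
            rw [List.prod_cons, mul_assoc]
        _ = T.V q ^ r * T.V j * (X' * L.prod) := by rw [h']; simp only [mul_assoc]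
        _ = T.V q ^ r * (T.V j * L.prod) * X' := by rw [hc.eq]; simp only [mul_assoc]
        _ = (T.V q ^ r :: L).prod * (T.V j * (X * X')) := by
          rw [h, List.prod_cons]; simp only [mul_assoc]
  refine h3 _ fun Y hY => ?_
  obtain ⟨i, rfl⟩ := (List.mem_ofFn' _ _).1 hY
  exact ⟨_, _, rfl⟩

/-- `𝒟_A` is invariant under `V_j` for `j ∉ A`. -/
lemma V_mem_D {A : Finset (Fin n)} {j : Fin n} (hj : j ∉ A) {x : H} (hx : x ∈ T.D A) :
    T.V j x ∈ T.D A := by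
  rw [D, wanderingSubspace, Submodule.mem_iInf] at hx ⊢
  intro l
  obtain ⟨w, hw, rfl⟩ := hx l
  obtain ⟨X, hX, h⟩ := T.exists_V_mul_tuplePow j Aᶜ l
  refine ⟨T.V j (X w), ?_, (DFunLike.congr_fun h w).symm⟩
  have hXw := mem_kerAdjoint.1 (hX.kerAdjoint_mem hw)
  refine mem_kerAdjoint.2 fun i hi => ?_
  have hij : i ≠ j := fun h => hj (h ▸ hi)
  have := DFunLike.congr_fun (T.twisted i j hij) (X w)
  simpa [hXw i hi] using this

/-- `𝒟_A` is invariant under all `U_{ij}`. -/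
lemma u_mem_D (A : Finset (Fin n)) {i j : Fin n} (h : i ≠ j) {x : H} (hx : x ∈ T.D A) :
    (T.u i j : H →L[ℂ] H) x ∈ T.D A :=
  (T.isCentral_u h).D_mem hx

/-- The restriction `V_j|_{𝒟_A}`, `j ∉ A`. -/
def resV (A : Finset (Fin n)) (j : Fin n) (hj : j ∉ A) : T.D A →L[ℂ] T.D A :=
  (T.V j).restrict fun _ hx => T.V_mem_D hj hx

/-- The restriction `U_{ij}|_{𝒟_A}`, `i ≠ j`, a unitary operator on `𝒟_A`. -/
def resU (A : Finset (Fin n)) (i j : Fin n) (h : i ≠ j) : unitary (T.D A →L[ℂ] T.D A) :=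
  ⟨(T.u i j : H →L[ℂ] H).restrict fun _ hx => T.u_mem_D A h hx, by
    have hu := Unitary.mul_star_self_of_mem (T.u i j).2
    have hu' := Unitary.star_mul_self_of_mem (T.u i j).2
    have hs : star ((T.u i j : H →L[ℂ] H).restrict fun _ hx => T.u_mem_D A h hx)
        = (star (T.u i j : H →L[ℂ] H)).restrict
          fun _ hx => (T.isCentral_u h).star_mem.D_mem (A := A) hx := by
      rw [ContinuousLinearMap.star_eq_adjoint, eq_comm, ContinuousLinearMap.eq_adjoint_iff]
      intro x y
      exact ContinuousLinearMap.adjoint_inner_left (T.u i j : H →L[ℂ] H) (y : H) (x : H)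
    rw [Unitary.mem_iff, hs]
    constructor
    · ext x
      exact DFunLike.congr_fun hu' (x : H)
    · ext x
      exact DFunLike.congr_fun hu (x : H)⟩

lemma ne_of_lt_index (A : Finset (Fin n)) {t : Fin n} (ht : t ∈ A)
    (r : Fin ((A.orderIsoOfFin rfl).symm ⟨t, ht⟩).1) :
    t ≠ A.orderEmbOfFin rfl (r.castLT (r.2.trans ((A.orderIsoOfFin rfl).symm ⟨t, ht⟩).2)) := by
  intro h
  have h1 : (A.orderIsoOfFin rfl).symm ⟨t, ht⟩
      = r.castLT (r.2.trans ((A.orderIsoOfFin rfl).symm ⟨t, ht⟩).2) := by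
    rw [OrderIso.symm_apply_eq]
    exact Subtype.ext h
  exact absurd (congrArg Fin.val h1) r.2.ne'

open Hardy

/-- The model operator `M_{A,t}` on `H²_{𝒟_A}(𝔻^m)`, where `A = {p_1 < ⋯ < p_m}`:
* `M_{A,t} = M_{z_i} (D_1[U_{p_i p_1}] ⋯ D_{i-1}[U_{p_i p_{i-1}}])` if `t = p_i`;
* `M_{A,t} = (D_1[U_{t p_1}] ⋯ D_m[U_{t p_m}]) (I ⊗ V_t|_{𝒟_A})` if `t ∉ A`. -/
def modelOp (A : Finset (Fin n)) (t : Fin n) :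
    Hardy A.card (T.D A) →L[ℂ] Hardy A.card (T.D A) :=
  if ht : t ∈ A then
    let i : Fin A.card := (A.orderIsoOfFin rfl).symm ⟨t, ht⟩
    mulCoord i * (List.ofFn fun r : Fin i.1 =>
      diagOp (r.castLT (r.2.trans i.2))
        (T.resU A t (A.orderEmbOfFin rfl (r.castLT (r.2.trans i.2)))
          (ne_of_lt_index A ht r))).prod
  else
    (List.ofFn fun r : Fin A.card =>
      diagOp r (T.resU A t (A.orderEmbOfFin rfl r)
        (fun h => ht (h ▸ A.orderEmbOfFin_mem rfl r)))).prod *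
    idTensor A.card (T.resV A t ht)

/-- The Hilbert space `⨁_{A ⊆ I_n} H²_{𝒟_A}(𝔻^{|A|})`. -/
abbrev ModelSpace : Type _ :=
  PiLp 2 fun A : Finset (Fin n) => Hardy A.card (T.D A)

/-- The model tuple `M_{V,t} = ⨁_{A ⊆ I_n} M_{A,t}`. -/
def model (t : Fin n) : T.ModelSpace →L[ℂ] T.ModelSpace :=
  (PiLp.continuousLinearEquiv 2 ℂ _).symm.toContinuousLinearMap ∘L
    ContinuousLinearMap.piMap (fun A => T.modelOp A t) ∘L
    (PiLp.continuousLinearEquiv 2 ℂ _).toContinuousLinearMap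

lemma model_apply (t : Fin n) (f : T.ModelSpace) (A : Finset (Fin n)) :
    T.model t f A = T.modelOp A t (f A) := rfl

end TwistedIsometry

end TwistedIsometries

end

noncomputable section

namespace TwistedIsometries

namespace TwistedIsometry

variable {n : ℕ} {H : Type*} [NormedAddCommGroup H] [InnerProductSpace ℂ H] [CompleteSpace H]
  (T : TwistedIsometry n H)

/-! ### Range projections of powers -/

/-! This is a simultaneous Wold decomposition. Let P_i(s) = V_i^s V_i^{*s}, a projection decreasing
in s. Moving V_j past P_i(s) for j ≠ i produces a central unitary and its inverse, which cancel
(`commute_V_rangeProj`). So projections with different indices commute, whereas V_i P_i(s) =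
P_i(s+1) V_i. For each i, the differences P_i(s) - P_i(s+1) and the strong limit of P_i(s) split H.
Doing this for all i at once gives joint weight spaces, indexed by functions κ from I_n to ℕ ∪ {∞}.
They are mutually orthogonal (`HasWeight.inner_eq_zero`) and span a dense subspace
(`mem_of_forall_hasWeight`).

The space 𝒟_A is exactly the weight space with weight 0 on A and ∞ off A (`mem_D_iff`), and V_A^k
carries it isometrically onto the one with weight k on A and ∞ off A. Every κ arises from exactly
one pair (A, k), so z^k η ↦ V_A^k η extends to a unitary from the model space onto H, whose inverse
is Π.

For the intertwining, V_t is moved to the right through V_A^k. Each V_j that it passes contributes a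
factor U_{tj}, and the collected powers are the diagonal operators of the model
(`V_mul_list_prod_self`, `V_mul_list_prod_of_ne`). -/

/-- The projection `V_i^s V_i^{*s}` onto the range of `V_i^s`. -/
def rangeProj (i : Fin n) (s : ℕ) : H →L[ℂ] H := T.V i ^ s * star (T.V i) ^ s

lemma rangeProj_zero (i : Fin n) : T.rangeProj i 0 = 1 := by simp [rangeProj]

lemma rangeProj_succ (i : Fin n) (s : ℕ) :
    T.rangeProj i (s + 1) = T.V i * T.rangeProj i s * star (T.V i) := by
  simp only [rangeProj, pow_succ' (T.V i), pow_succ (star (T.V i)), mul_assoc]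

lemma star_rangeProj (i : Fin n) (s : ℕ) : star (T.rangeProj i s) = T.rangeProj i s := by
  simp [rangeProj]

lemma star_pow_mul_pow (i : Fin n) (s : ℕ) : star (T.V i) ^ s * T.V i ^ s = 1 := by
  rw [← star_pow]
  exact star_mul_self_pow _ (T.isometry i) s

lemma rangeProj_mul_rangeProj_add (i : Fin n) (s t : ℕ) :
    T.rangeProj i s * T.rangeProj i (s + t) = T.rangeProj i (s + t) := by
  calc T.rangeProj i s * T.rangeProj i (s + t)
      = T.V i ^ s * (star (T.V i) ^ s * T.V i ^ s) * T.V i ^ t * star (T.V i) ^ (s + t) := by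
        simp only [rangeProj, pow_add (T.V i), mul_assoc]
    _ = T.rangeProj i (s + t) := by
        rw [star_pow_mul_pow, mul_one, rangeProj, pow_add (T.V i)]

lemma rangeProj_mul_of_le (i : Fin n) {s t : ℕ} (h : s ≤ t) :
    T.rangeProj i s * T.rangeProj i t = T.rangeProj i t := by
  obtain ⟨r, rfl⟩ := Nat.exists_eq_add_of_le h
  exact T.rangeProj_mul_rangeProj_add i s r

lemma rangeProj_mul_of_ge (i : Fin n) {s t : ℕ} (h : s ≤ t) :
    T.rangeProj i t * T.rangeProj i s = T.rangeProj i t := by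
  simpa [star_rangeProj] using congrArg star (T.rangeProj_mul_of_le i h)

variable {T} in
lemma IsCentral.commute_rangeProj {X : H →L[ℂ] H} (hX : T.IsCentral X) (i : Fin n) (s : ℕ) :
    Commute X (T.rangeProj i s) :=
  (Commute.pow_right (hX i).1.symm s).mul_right (Commute.pow_right (hX i).2.symm s)

lemma V_mul_rangeProj_self (i : Fin n) (s : ℕ) :
    T.V i * T.rangeProj i s = T.rangeProj i (s + 1) * T.V i := by
  rw [rangeProj_succ, mul_assoc _ (star (T.V i)), T.isometry, mul_one]

/-- Induction through P_i(s+1) = V_i P_i(s) V_i^*: exchanging V_i^* with V_j costs U_{ij}^*, and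
exchanging V_i with V_j costs U_{ij}. Centrality brings the two together, where they cancel. -/
lemma commute_V_rangeProj {i j : Fin n} (h : i ≠ j) (s : ℕ) :
    Commute (T.V j) (T.rangeProj i s) := by
  induction s with
  | zero => rw [rangeProj_zero]; exact Commute.one_right _
  | succ s ih =>
    have hu := Unitary.star_mul_self_of_mem (T.u i j).2
    have hc := (T.isCentral_u h).star_mem.commute_rangeProj i s
    have hv : star (T.u i j : H →L[ℂ] H) * (T.V i * T.V j) = T.V j * T.V i := by
      rw [T.V_mul_V h, ← mul_assoc, ← mul_assoc, hu, one_mul]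
    have hcv := ((T.isCentral_u h).star_mem i).1
    have ht : star (T.V i) * T.V j = star (T.u i j : H →L[ℂ] H) * T.V j * star (T.V i) :=
      T.twisted i j h
    symm
    change T.rangeProj i (s + 1) * T.V j = T.V j * T.rangeProj i (s + 1)
    calc T.rangeProj i (s + 1) * T.V j
        = T.V i * T.rangeProj i s * (star (T.V i) * T.V j) := by
          rw [rangeProj_succ, mul_assoc]
      _ = T.V i * (T.rangeProj i s * star (T.u i j : H →L[ℂ] H)) * T.V j * star (T.V i) := by
          rw [ht]; simp only [mul_assoc]
      _ = (T.V i * star (T.u i j : H →L[ℂ] H)) * (T.rangeProj i s * T.V j) * star (T.V i) := by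
          rw [← hc.eq]; simp only [mul_assoc]
      _ = (star (T.u i j : H →L[ℂ] H) * (T.V i * T.V j)) * T.rangeProj i s * star (T.V i) := by
          rw [hcv, ← ih.eq]; simp only [mul_assoc]
      _ = T.V j * T.rangeProj i (s + 1) := by
          rw [hv, rangeProj_succ]; simp only [mul_assoc]

lemma commute_star_V_rangeProj {i j : Fin n} (h : i ≠ j) (s : ℕ) :
    Commute (star (T.V j)) (T.rangeProj i s) := by
  simpa [star_rangeProj] using (T.commute_V_rangeProj h s).star_star

lemma commute_rangeProj {i j : Fin n} (h : i ≠ j) (s t : ℕ) :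
    Commute (T.rangeProj j t) (T.rangeProj i s) :=
  ((T.commute_V_rangeProj h s).pow_left t).mul_left
    ((T.commute_star_V_rangeProj h s).pow_left t)

lemma star_V_apply_eq_zero_iff (i : Fin n) (x : H) :
    star (T.V i) x = 0 ↔ T.rangeProj i 1 x = 0 := by
  constructor
  · intro h
    simp [rangeProj, h]
  · intro h
    have h1 := congrArg (fun y => star (T.V i) y) h
    have h2 := DFunLike.congr_fun (T.isometry i) (star (T.V i) x)
    simp only [rangeProj, pow_one, mul_apply_eq_comp, map_zero] at h1 h2
    rw [h2] at h1
    simpa using h1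

lemma inner_rangeProj (i : Fin n) (s : ℕ) (x y : H) :
    inner ℂ (T.rangeProj i s x) y = inner ℂ x (T.rangeProj i s y) := by
  conv_lhs => rw [← T.star_rangeProj]
  exact ContinuousLinearMap.adjoint_inner_left _ _ _

/-- The projections `V_i^s V_i^{*s}` converge strongly as `s → ∞`. -/
lemma exists_tendsto_rangeProj (i : Fin n) (x : H) :
    ∃ y, Filter.Tendsto (fun s => T.rangeProj i s x) Filter.atTop (nhds y) := by
  -- The complements 1 - P_i(s) are the orthogonal projections onto the increasing subspaces ker
  -- P_i(s), so they converge strongly to the projection onto the closure of the union.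
  let K : ℕ → Submodule ℂ H := fun s => (T.rangeProj i s).ker
  have hK : ∀ s, CompleteSpace (K s) := fun s =>
    (T.rangeProj i s).isClosed_ker.completeSpace_coe
  have hmono : Monotone K := by
    intro s t hst y hy
    have hy' : T.rangeProj i s y = 0 := hy
    change T.rangeProj i t y = 0
    rw [← T.rangeProj_mul_of_ge i hst, mul_apply_eq_comp, hy', map_zero]
  have hproj : ∀ s, (K s).starProjection x = x - T.rangeProj i s x := by
    intro s
    refine Submodule.eq_starProjection_of_mem_of_inner_eq_zero ?_ ?_
    · change T.rangeProj i s (x - T.rangeProj i s x) = 0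
      rw [map_sub, ← mul_apply_eq_comp, T.rangeProj_mul_of_le i le_rfl, sub_self]
    · intro w hw
      have hw' : T.rangeProj i s w = 0 := hw
      rw [sub_sub_cancel, inner_rangeProj, hw', inner_zero_right]
  have h := Submodule.starProjection_tendsto_closure_iSup K hmono x
  refine ⟨_, (h.const_sub x).congr fun s => ?_⟩
  rw [hproj, sub_sub_cancel]

/-! ### Homogeneous isometries -/

/-- An isometry `X` is homogeneous of degree `d` if it behaves like a product of the `V_i` in which
each `V_i` occurs `d i` times. -/
structure IsHomogeneous (X : H →L[ℂ] H) (d : Fin n → ℕ) : Prop where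
  star_mul_self : star X * X = 1
  mul_rangeProj : ∀ i s, X * T.rangeProj i s = T.rangeProj i (s + d i) * X
  mul_star_apply : ∀ x, (∀ i, T.rangeProj i (d i) x = x) → X (star X x) = x

namespace IsHomogeneous

variable {T} {X Y : H →L[ℂ] H} {d e : Fin n → ℕ}

lemma rangeProj_mul_star (hX : T.IsHomogeneous X d) (i : Fin n) (s : ℕ) :
    T.rangeProj i s * star X = star X * T.rangeProj i (s + d i) := by
  simpa [star_rangeProj] using congrArg star (hX.mul_rangeProj i s)

variable (T) in
lemma one : T.IsHomogeneous 1 0 :=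
  ⟨by simp, fun i s => by simp, fun x _ => by simp⟩

/-- The clause with content is the last. It says that the range of X contains the intersection of
the ranges of the V_i^{d i}. It passes to products because X^* lowers each degree by d i, so X^* x
still lies in the ranges required by Y. -/
lemma mul (hX : T.IsHomogeneous X d) (hY : T.IsHomogeneous Y e) :
    T.IsHomogeneous (X * Y) (d + e) where
  star_mul_self := by
    rw [star_mul, mul_assoc, ← mul_assoc (star X), hX.star_mul_self, one_mul, hY.star_mul_self]
  mul_rangeProj i s := by
    rw [mul_assoc, hY.mul_rangeProj, ← mul_assoc, hX.mul_rangeProj, mul_assoc, Pi.add_apply,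
      add_assoc, add_comm (e i)]
  mul_star_apply x hx := by
    have h1 : ∀ i, T.rangeProj i (e i) (star X x) = star X x := fun i => by
      have := DFunLike.congr_fun (hX.rangeProj_mul_star i (e i)) x
      rw [mul_apply_eq_comp, mul_apply_eq_comp, add_comm] at this
      rw [this]
      exact congrArg _ (hx i)
    have h2 : ∀ i, T.rangeProj i (d i) x = x := fun i => by
      conv_lhs => rw [← hx i]
      rw [← mul_apply_eq_comp, Pi.add_apply, T.rangeProj_mul_rangeProj_add]
      exact hx i
    rw [star_mul, mul_apply_eq_comp, mul_apply_eq_comp,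
      hY.mul_star_apply _ h1, hX.mul_star_apply _ h2]

variable (T) in
lemma V (i : Fin n) : T.IsHomogeneous (T.V i) (Pi.single i 1) where
  star_mul_self := T.isometry i
  mul_rangeProj j s := by
    by_cases h : j = i
    · subst h
      simpa using T.V_mul_rangeProj_self j s
    · simpa [h] using (T.commute_V_rangeProj h s).eq
  mul_star_apply x hx := by simpa [rangeProj] using hx i

lemma pow (hX : T.IsHomogeneous X d) (r : ℕ) : T.IsHomogeneous (X ^ r) (r • d) := by
  induction r with
  | zero => simpa using one T
  | succ r ih =>
    rw [pow_succ, succ_nsmul]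
    exact ih.mul hX

lemma list_prod {m : ℕ} {X : Fin m → H →L[ℂ] H} {d : Fin m → Fin n → ℕ}
    (h : ∀ j, T.IsHomogeneous (X j) (d j)) : T.IsHomogeneous (List.ofFn X).prod (∑ j, d j) := by
  induction m with
  | zero => simpa using one T
  | succ m ih =>
    rw [List.ofFn_succ, List.prod_cons, Fin.sum_univ_succ]
    exact (h 0).mul (ih fun j => h j.succ)

end IsHomogeneous

/-- The degree of `V_B^l`. -/
def tupleDegree (B : Finset (Fin n)) (l : Fin B.card → ℕ) : Fin n → ℕ :=
  ∑ j, l j • Pi.single (B.orderEmbOfFin rfl j) 1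

lemma tupleDegree_orderEmbOfFin (B : Finset (Fin n)) (l : Fin B.card → ℕ) (j : Fin B.card) :
    tupleDegree B l (B.orderEmbOfFin rfl j) = l j := by
  rw [tupleDegree, Finset.sum_apply, Finset.sum_eq_single j]
  · simp
  · intro r _ hr
    simp [hr.symm]
  · simp

lemma tupleDegree_of_notMem {B : Finset (Fin n)} (l : Fin B.card → ℕ) {i : Fin n} (hi : i ∉ B) :
    tupleDegree B l i = 0 := by
  rw [tupleDegree, Finset.sum_apply]
  refine Finset.sum_eq_zero fun j _ => ?_
  have : i ≠ B.orderEmbOfFin rfl j := fun h => hi (h ▸ B.orderEmbOfFin_mem rfl j)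
  simp [this]

lemma exists_orderEmbOfFin_eq {B : Finset (Fin n)} {i : Fin n} (hi : i ∈ B) :
    ∃ j, B.orderEmbOfFin rfl j = i := by
  have : i ∈ Set.range (B.orderEmbOfFin rfl) := by simpa using hi
  exact this

/-- From here on the weight arguments see V_B^l only through its degree; the order of the factors
and the unitaries U_{ij} no longer enter. -/
lemma isHomogeneous_tuplePow (B : Finset (Fin n)) (l : Fin B.card → ℕ) :
    T.IsHomogeneous (tuplePow T.V B l) (tupleDegree B l) :=
  IsHomogeneous.list_prod fun _ => (IsHomogeneous.V T _).pow _

/-! ### Weight spaces -/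

/-- `x` has weight `c` with respect to `V_i` if it lies in the range of `V_i^s` for `s ≤ c` and is
orthogonal to it for `s > c`. -/
def HasWeightAt (i : Fin n) (c : ℕ∞) (x : H) : Prop :=
  ∀ s : ℕ, T.rangeProj i s x = if (s : ℕ∞) ≤ c then x else 0

/-- `x` is a joint weight vector of weight `κ`. -/
def HasWeight (κ : Fin n → ℕ∞) (x : H) : Prop := ∀ i, T.HasWeightAt i (κ i) x

variable {T}

lemma hasWeightAt_top {i : Fin n} {x : H} (h : ∀ s, T.rangeProj i s x = x) :
    T.HasWeightAt i ⊤ x := fun s => by simp [h]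

lemma hasWeightAt_nat {i : Fin n} {c : ℕ} {x : H} (h : T.rangeProj i c x = x)
    (h' : T.rangeProj i (c + 1) x = 0) : T.HasWeightAt i c x := by
  intro s
  split_ifs with hs
  · rw [Nat.cast_le] at hs
    rw [← h, ← mul_apply_eq_comp, T.rangeProj_mul_of_le i hs]
  · rw [Nat.cast_le, not_le] at hs
    rw [← T.rangeProj_mul_of_ge i (Nat.add_one_le_of_lt hs), mul_apply_eq_comp, h', map_zero]

lemma HasWeightAt.map {i : Fin n} {c : ℕ∞} {x : H} (h : T.HasWeightAt i c x) {X : H →L[ℂ] H}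
    (hX : ∀ s, Commute X (T.rangeProj i s)) : T.HasWeightAt i c (X x) := by
  intro s
  have h1 := DFunLike.congr_fun (hX s).eq x
  rw [mul_apply_eq_comp, mul_apply_eq_comp, h s] at h1
  rw [← h1]
  split_ifs <;> simp

lemma IsHomogeneous.hasWeight {X : H →L[ℂ] H} {d : Fin n → ℕ} (hX : T.IsHomogeneous X d)
    {κ : Fin n → ℕ∞} {x : H} (hx : T.HasWeight κ x) : T.HasWeight (fun i => κ i + d i) (X x) := by
  have key : ∀ i s, T.rangeProj i (s + d i) (X x) = X (T.rangeProj i s x) := fun i s =>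
    (DFunLike.congr_fun (hX.mul_rangeProj i s) x).symm
  intro i s
  rcases le_total (d i) s with h | h
  · obtain ⟨r, rfl⟩ := Nat.exists_eq_add_of_le' h
    rw [key, hx i r]
    have : ((r + d i : ℕ) : ℕ∞) ≤ κ i + d i ↔ (r : ℕ∞) ≤ κ i := by
      rw [Nat.cast_add]
      exact ENat.add_le_add_iff_right (ENat.natCast_ne_top _)
    simp only [this]
    split_ifs <;> simp
  -- For s ≤ d i nothing about x is needed: X x lies in the range of V_i^{d i}, hence in that of
  -- V_i^s.
  · have h0 := key i 0
    rw [zero_add, T.rangeProj_zero, one_apply_eq_self] at h0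
    have : (s : ℕ∞) ≤ κ i + d i := (Nat.cast_le.2 h).trans le_add_self
    rw [if_pos this]
    conv_lhs => rw [← h0]
    rw [← mul_apply_eq_comp, T.rangeProj_mul_of_le i h, h0]

/-- At an index where the weights differ, let c be the smaller, necessarily finite, value. The
self-adjoint P_i(c+1) kills one vector and fixes the other. -/
lemma HasWeight.inner_eq_zero {κ κ' : Fin n → ℕ∞} {x y : H} (hx : T.HasWeight κ x)
    (hy : T.HasWeight κ' y) (h : κ ≠ κ') : inner ℂ x y = 0 := by
  obtain ⟨i, hi⟩ := Function.ne_iff.1 h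
  rcases lt_or_gt_of_ne hi with hi | hi
  · lift κ i to ℕ using hi.ne_top with c hc
    have h1 := hx i (c + 1)
    have h2 := hy i (c + 1)
    rw [if_neg (by rw [← hc, not_le]; exact_mod_cast c.lt_succ_self)] at h1
    rw [if_pos (by simpa using Order.add_one_le_of_lt hi)] at h2
    rw [← h2, ← inner_rangeProj, h1, inner_zero_left]
  · lift κ' i to ℕ using hi.ne_top with c hc
    have h1 := hx i (c + 1)
    have h2 := hy i (c + 1)
    rw [if_neg (by rw [← hc, not_le]; exact_mod_cast c.lt_succ_self)] at h2
    rw [if_pos (by simpa using Order.add_one_le_of_lt hi)] at h1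
    rw [← h1, inner_rangeProj, h2, inner_zero_right]

/-- The weight of the vectors of `𝒟_A`. -/
def baseWeight (A : Finset (Fin n)) (i : Fin n) : ℕ∞ := if i ∈ A then 0 else ⊤

/-- Membership in the intersection over all l is tested on two kinds of exponent: l = 0 gives weight
0 on A, and the constant exponents s give weight ∞ off A. Conversely, a vector of this weight equals
V^l applied to its image under (V^l)^*, and that image is in 𝒲_A. -/
lemma mem_D_iff {A : Finset (Fin n)} {x : H} : x ∈ T.D A ↔ T.HasWeight (baseWeight A) x := by
  rw [D, wanderingSubspace, Submodule.mem_iInf]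
  constructor
  · intro h i
    by_cases hi : i ∈ A
    · rw [baseWeight, if_pos hi]
      obtain ⟨w, hw, rfl⟩ := h 0
      have hX := T.isHomogeneous_tuplePow Aᶜ 0
      refine hasWeightAt_nat (c := 0) (by simp [rangeProj_zero]) ?_
      have h1 := DFunLike.congr_fun (hX.mul_rangeProj i 1) w
      rw [tupleDegree_of_notMem _ (by simpa using hi)] at h1
      have h2 := (T.star_V_apply_eq_zero_iff i w).1 (mem_kerAdjoint.1 hw i hi)
      simp only [mul_apply_eq_comp, h2, map_zero] at h1
      exact h1.symm
    · rw [baseWeight, if_neg hi]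
      refine hasWeightAt_top fun s => ?_
      obtain ⟨w, hw, rfl⟩ := h fun _ => s
      have hX := T.isHomogeneous_tuplePow Aᶜ fun _ => s
      obtain ⟨j, rfl⟩ := exists_orderEmbOfFin_eq (Finset.mem_compl.2 hi)
      have h1 := DFunLike.congr_fun (hX.mul_rangeProj (Aᶜ.orderEmbOfFin rfl j) 0) w
      rw [tupleDegree_orderEmbOfFin, zero_add, rangeProj_zero, mul_one] at h1
      exact h1.symm
  · intro h l
    have hX := T.isHomogeneous_tuplePow Aᶜ l
    refine ⟨star (tuplePow T.V Aᶜ l) x, ?_, hX.mul_star_apply x fun i => ?_⟩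
    · refine mem_kerAdjoint.2 fun i hi => (T.star_V_apply_eq_zero_iff i _).2 ?_
      have h1 := DFunLike.congr_fun (hX.rangeProj_mul_star i 1) x
      have h2 := h i 1
      rw [baseWeight, if_pos hi, if_neg (by simp)] at h2
      rw [tupleDegree_of_notMem _ (by simpa using hi)] at h1
      simp only [mul_apply_eq_comp, h2, add_zero, map_zero] at h1
      exact h1
    · by_cases hi : i ∈ A
      · rw [tupleDegree_of_notMem _ (by simpa using hi), rangeProj_zero]
        rfl
      · have h2 := h i (tupleDegree Aᶜ l i)
        rwa [baseWeight, if_neg hi, if_pos le_top] at h2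

/-- The weight of the vectors of `V_A^k 𝒟_A`. -/
def tupleWeight (A : Finset (Fin n)) (k : Fin A.card → ℕ) (i : Fin n) : ℕ∞ :=
  baseWeight A i + tupleDegree A k i

lemma hasWeight_tuplePow {A : Finset (Fin n)} (k : Fin A.card → ℕ) {x : H} (hx : x ∈ T.D A) :
    T.HasWeight (tupleWeight A k) (tuplePow T.V A k x) :=
  (T.isHomogeneous_tuplePow A k).hasWeight (mem_D_iff.1 hx)

/-- The infinite coordinates of the weight recover A; the finite ones then recover k. Hence distinct
pairs (A, k) give orthogonal subspaces. -/
lemma tupleWeight_eq_top_iff {A : Finset (Fin n)} {k : Fin A.card → ℕ} {i : Fin n} :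
    tupleWeight A k i = ⊤ ↔ i ∉ A := by
  by_cases hi : i ∈ A <;> simp [tupleWeight, baseWeight, hi]

lemma tupleWeight_ne_of_ne {A B : Finset (Fin n)} (h : A ≠ B) (k : Fin A.card → ℕ)
    (l : Fin B.card → ℕ) : tupleWeight A k ≠ tupleWeight B l := by
  intro hw
  refine h (Finset.ext fun i => ?_)
  rw [← not_iff_not, ← tupleWeight_eq_top_iff (k := k), hw, tupleWeight_eq_top_iff]

lemma tupleWeight_injective (A : Finset (Fin n)) : Function.Injective (tupleWeight A) := by
  intro k l h
  funext j
  have := congrFun h (A.orderEmbOfFin rfl j)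
  simpa [tupleWeight, baseWeight, tupleDegree_orderEmbOfFin] using this

/-- Every weight vector lies in some `V_A^k 𝒟_A`. -/
lemma HasWeight.exists_tuplePow {κ : Fin n → ℕ∞} {x : H} (hx : T.HasWeight κ x) :
    ∃ (A : Finset (Fin n)) (k : Fin A.card → ℕ), ∃ w ∈ T.D A, tuplePow T.V A k w = x := by
  -- A collects the coordinates of finite weight and k records their values, so that V_A^{k*} lowers
  -- these to 0 and leaves the infinite ones unchanged.
  let A : Finset (Fin n) := Finset.univ.filter fun i => κ i ≠ ⊤
  let k : Fin A.card → ℕ := fun j => (κ (A.orderEmbOfFin rfl j)).toNat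
  have hA : ∀ i, i ∈ A ↔ κ i ≠ ⊤ := fun i => by simp [A]
  have hk : ∀ i ∈ A, (tupleDegree A k i : ℕ∞) = κ i := by
    intro i hi
    obtain ⟨j, rfl⟩ := exists_orderEmbOfFin_eq hi
    rw [tupleDegree_orderEmbOfFin]
    exact ENat.natCast_toNat ((hA _).1 hi)
  have hX := T.isHomogeneous_tuplePow A k
  refine ⟨A, k, star (tuplePow T.V A k) x, mem_D_iff.2 fun i => ?_,
    hX.mul_star_apply x fun i => ?_⟩
  · have h1 : ∀ s, T.rangeProj i s (star (tuplePow T.V A k) x)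
        = star (tuplePow T.V A k) (T.rangeProj i (s + tupleDegree A k i) x) := fun s =>
      DFunLike.congr_fun (hX.rangeProj_mul_star i s) x
    by_cases hi : i ∈ A
    · rw [baseWeight, if_pos hi]
      refine hasWeightAt_nat (c := 0) (by simp [rangeProj_zero]) ?_
      rw [h1, hx i, ← hk i hi, if_neg, map_zero]
      rw [Nat.cast_le]
      omega
    · rw [baseWeight, if_neg hi]
      refine hasWeightAt_top fun s => ?_
      have : κ i = ⊤ := by simpa [hA] using hi
      rw [h1, hx i, this, if_pos le_top]
  · by_cases hi : i ∈ A
    · rw [hx i, if_pos (hk i hi).le]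
    · rw [tupleDegree_of_notMem _ hi, rangeProj_zero]
      rfl

/-- A closed subspace containing all weight vectors is the whole space. -/
lemma mem_of_forall_hasWeight {S : Submodule ℂ H} (hS : IsClosed (S : Set H))
    (h : ∀ κ x, T.HasWeight κ x → x ∈ S) (x : H) : x ∈ S := by
  -- F is the set of indices at which x need not yet have a weight. The values of κ on F play no
  -- role, so the case F = I_n may start from κ = 0.
  suffices key : ∀ (F : Finset (Fin n)) (κ : Fin n → ℕ∞) (x : H),
      (∀ i ∉ F, T.HasWeightAt i (κ i) x) → x ∈ S from
    key Finset.univ 0 x fun i hi => absurd (Finset.mem_univ i) hi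
  intro F
  induction F using Finset.induction_on with
  | empty => exact fun κ x hx => h κ x fun i => hx i (by simp)
  | insert j F hj ih =>
    intro κ x hx
    have hmem : ∀ (c : ℕ∞) (y : H), T.HasWeightAt j c y →
        (∀ i ∉ insert j F, T.HasWeightAt i (κ i) y) → y ∈ S := by
      intro c y hy hy'
      refine ih (Function.update κ j c) y fun i hi => ?_
      by_cases hij : i = j
      · subst hij
        simpa using hy
      · rw [Function.update_of_ne hij]
        exact hy' i (by simp [hij, hi])
    have hproj : ∀ s, ∀ i ∉ insert j F, T.HasWeightAt i (κ i) (T.rangeProj j s x) := by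
      intro s i hi
      have hij : i ≠ j := fun h => hi (h ▸ Finset.mem_insert_self _ _)
      exact (hx i hi).map fun t => T.commute_rangeProj hij t s
    -- The difference has weight exactly s at j, and it keeps the weights of x outside F ∪ {j}
    -- because projections of different indices commute. These differences telescope to x - P_j(s)
    -- x.
    have hdiff : ∀ s, T.rangeProj j s x - T.rangeProj j (s + 1) x ∈ S := by
      intro s
      refine hmem s _ (hasWeightAt_nat ?_ ?_) fun i hi => ?_
      · simp only [map_sub, ← mul_apply_eq_comp, T.rangeProj_mul_of_le j le_rfl,
          T.rangeProj_mul_of_le j s.le_succ]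
      · simp only [map_sub, ← mul_apply_eq_comp, T.rangeProj_mul_of_le j le_rfl,
          T.rangeProj_mul_of_ge j s.le_succ, sub_self]
      · have hij : i ≠ j := fun h => hi (h ▸ Finset.mem_insert_self _ _)
        exact (hx i hi).map (X := T.rangeProj j s - T.rangeProj j (s + 1)) fun t =>
          (T.commute_rangeProj hij t s).sub_left (T.commute_rangeProj hij t (s + 1))
    have hsub : ∀ s, x - T.rangeProj j s x ∈ S := by
      intro s
      induction s with
      | zero => simp [rangeProj_zero]
      | succ s ihs => simpa using S.add_mem ihs (hdiff s)
    obtain ⟨y, hy⟩ := T.exists_tendsto_rangeProj j x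
    -- The limit y is fixed by every P_j(s), so it is the part of x of weight ∞ at j.
    have hyS : y ∈ S := by
      refine hmem ⊤ y (hasWeightAt_top fun s => ?_) fun i hi s => ?_
      · refine tendsto_nhds_unique (((T.rangeProj j s).continuous.tendsto y).comp hy)
          (hy.congr' ?_)
        filter_upwards [Filter.eventually_ge_atTop s] with t ht
        exact (DFunLike.congr_fun (T.rangeProj_mul_of_le j ht) x).symm
      · refine tendsto_nhds_unique (((T.rangeProj i s).continuous.tendsto y).comp hy) ?_
        have : ∀ t, (if (s : ℕ∞) ≤ κ i then T.rangeProj j t x else 0)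
            = T.rangeProj i s (T.rangeProj j t x) := fun t => (hproj t i hi s).symm
        refine Filter.Tendsto.congr this ?_
        split_ifs
        · exact hy
        · exact tendsto_const_nhds
    have hxy : x - y ∈ S :=
      hS.mem_of_tendsto (hy.const_sub x) (Filter.Eventually.of_forall hsub)
    simpa using S.add_mem hxy hyS

end TwistedIsometry

/-! ### Taylor coefficients of the model operators -/

namespace Hardy

variable {m : ℕ} {E : Type*} [NormedAddCommGroup E] [InnerProductSpace ℂ E] [CompleteSpace E]

lemma coeff_mulCoord (i : Fin m) (f : Hardy m E) :
    coeff m E (mulCoord i f) = shiftCoeff i (coeff m E f) :=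
  coeff_eq_of_hasSum _ _ (hasSum_shiftCoeff i f)

lemma coeff_list_prod_diagOp {p : ℕ} (c : Fin p → Fin m) (U : Fin p → unitary (E →L[ℂ] E))
    (f : Hardy m E) (k : Fin m → ℕ) :
    coeff m E ((List.ofFn fun r => diagOp (c r) (U r)).prod f) k
      = (List.ofFn fun r => (U r : E →L[ℂ] E) ^ k (c r)).prod (coeff m E f k) := by
  induction p with
  | zero => simp
  | succ p ih =>
    rw [List.ofFn_succ, List.ofFn_succ, List.prod_cons, List.prod_cons, mul_apply_eq_comp,
      mul_apply_eq_comp, coeff_diagOp, ih]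

end Hardy

namespace TwistedIsometry

open Hardy

variable {n : ℕ} {H : Type*} [NormedAddCommGroup H] [InnerProductSpace ℂ H] [CompleteSpace H]
  (T : TwistedIsometry n H)

/-! ### The unitary onto the model space -/

/-- The isometry `V_A^k|_{𝒟_A}`. -/
def tupleIsometry (A : Finset (Fin n)) (k : Fin A.card → ℕ) : T.D A →ₗᵢ[ℂ] H where
  toLinearMap := (tuplePow T.V A k).toLinearMap ∘ₗ (T.D A).subtype
  norm_map' x := (T.isometry_tuplePow A k).norm_map_of_map_zero (map_zero _) (x : H)

lemma tupleIsometry_apply (A : Finset (Fin n)) (k : Fin A.card → ℕ) (x : T.D A) :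
    T.tupleIsometry A k x = tuplePow T.V A k x := rfl

lemma orthogonalFamily_tupleIsometry (A : Finset (Fin n)) :
    OrthogonalFamily ℂ (fun _ : Fin A.card → ℕ => T.D A) (T.tupleIsometry A) :=
  fun k l hkl x y => (hasWeight_tuplePow k x.2).inner_eq_zero (hasWeight_tuplePow l y.2)
    ((tupleWeight_injective A).ne hkl)

/-- The isometry `H²_{𝒟_A}(𝔻^{|A|}) → H`, `∑_k z^k a_k ↦ ∑_k V_A^k a_k`. -/
def synthesis (A : Finset (Fin n)) : Hardy A.card (T.D A) →ₗᵢ[ℂ] H :=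
  (T.orthogonalFamily_tupleIsometry A).linearIsometry.comp
    (coeff A.card (T.D A)).toLinearIsometry

lemma hasSum_synthesis (A : Finset (Fin n)) (f : Hardy A.card (T.D A)) :
    HasSum (fun k => tuplePow T.V A k (coeff A.card (T.D A) f k : H)) (T.synthesis A f) :=
  (T.orthogonalFamily_tupleIsometry A).hasSum_linearIsometry (coeff A.card (T.D A) f)

lemma synthesis_monomial (A : Finset (Fin n)) (k : Fin A.card → ℕ) (x : T.D A) :
    T.synthesis A ((coeff A.card (T.D A)).symm (lp.single 2 k x)) = tuplePow T.V A k x := by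
  change (T.orthogonalFamily_tupleIsometry A).linearIsometry
    (coeff A.card (T.D A) ((coeff A.card (T.D A)).symm (lp.single 2 k x))) = _
  rw [LinearIsometryEquiv.apply_symm_apply, OrthogonalFamily.linearIsometry_apply_single,
    tupleIsometry_apply]

lemma orthogonalFamily_synthesis :
    OrthogonalFamily ℂ (fun A : Finset (Fin n) => Hardy A.card (T.D A)) T.synthesis := by
  intro A B hAB f g
  -- Both vectors are expanded in series, one at a time. The inner product is linear only in its
  -- second argument, so the roles are swapped before the second expansion.
  refine ((T.hasSum_synthesis B g).mapL (innerSL ℂ (T.synthesis A f))).unique ?_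
  convert! hasSum_zero with l
  rw [innerSL_apply_apply, inner_eq_zero_symm]
  refine ((T.hasSum_synthesis A f).mapL (innerSL ℂ _)).unique ?_
  convert! hasSum_zero with k
  exact (hasWeight_tuplePow l (Subtype.prop _)).inner_eq_zero
    (hasWeight_tuplePow k (Subtype.prop _)) (tupleWeight_ne_of_ne hAB.symm l k)

/-- The isometry `⨁_A H²_{𝒟_A}(𝔻^{|A|}) → H`. -/
def modelIsometry : T.ModelSpace →ₗᵢ[ℂ] H where
  toFun f := ∑ A, T.synthesis A (f A)
  map_add' f g := by simp [Finset.sum_add_distrib]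
  map_smul' c f := by simp [Finset.smul_sum]
  norm_map' f := by
    refine (sq_eq_sq₀ (norm_nonneg _) (norm_nonneg _)).1 ?_
    rw [PiLp.norm_sq_eq_of_L2]
    exact T.orthogonalFamily_synthesis.norm_sum (fun A => f A) Finset.univ

lemma modelIsometry_apply (f : T.ModelSpace) :
    T.modelIsometry f = ∑ A, T.synthesis A (f A) := rfl

lemma modelIsometry_surjective : Function.Surjective T.modelIsometry := by
  intro x
  have hclosed : IsClosed (T.modelIsometry.toLinearMap.range : Set H) :=
    T.modelIsometry.isometry.isClosedEmbedding.isClosed_range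
  -- The range is closed, so it suffices to reach weight vectors. Each is V_A^k w with w in 𝒟_A, the
  -- image of z^k w in the A-th summand.
  refine mem_of_forall_hasWeight (T := T) hclosed (fun κ x hx => ?_) x
  obtain ⟨A, k, w, hw, rfl⟩ := hx.exists_tuplePow
  refine ⟨WithLp.toLp 2 (Pi.single A ((coeff A.card (T.D A)).symm (lp.single 2 k ⟨w, hw⟩))), ?_⟩
  change ∑ B, T.synthesis B _ = _
  rw [Finset.sum_eq_single A]
  · simp [synthesis_monomial]
  · intro B _ hB
    simp [hB]
  · simp

/-! ### Intertwining -/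

lemma V_mul_pow {i j : Fin n} (h : i ≠ j) (r : ℕ) :
    T.V i * T.V j ^ r = (T.u i j : H →L[ℂ] H) ^ r * T.V j ^ r * T.V i := by
  have hc : ∀ s, Commute (T.V j ^ s) (T.u i j : H →L[ℂ] H) := fun s =>
    Commute.pow_left (T.isCentral_u h j).1 s
  induction r with
  | zero => simp
  | succ r ih =>
    calc T.V i * T.V j ^ (r + 1) = T.V i * T.V j ^ r * T.V j := by rw [pow_succ, mul_assoc]
      _ = (T.u i j : H →L[ℂ] H) ^ r * T.V j ^ r * (T.V i * T.V j) := by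
        rw [ih]; simp only [mul_assoc]
      _ = (T.u i j : H →L[ℂ] H) ^ r * (T.V j ^ r * (T.u i j : H →L[ℂ] H)) * T.V j * T.V i := by
        rw [T.V_mul_V h]; simp only [mul_assoc]
      _ = (T.u i j : H →L[ℂ] H) ^ (r + 1) * T.V j ^ (r + 1) * T.V i := by
        rw [(hc r).eq, pow_succ, pow_succ]; simp only [mul_assoc]

/-- The central powers are collected to the right of the V-product, since in the model they act on
the coefficient in 𝒟_A before V_A^k is applied. -/
lemma V_mul_list_prod_of_ne {p : ℕ} (t : Fin n) (c : Fin p → Fin n) (h : ∀ r, t ≠ c r)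
    (k : Fin p → ℕ) :
    T.V t * (List.ofFn fun r => T.V (c r) ^ k r).prod
      = (List.ofFn fun r => T.V (c r) ^ k r).prod
        * (List.ofFn fun r => (T.u t (c r) : H →L[ℂ] H) ^ k r).prod * T.V t := by
  induction p with
  | zero => simp
  | succ p ih =>
    simp only [List.ofFn_succ, List.prod_cons]
    have ih := ih (fun r => c r.succ) (fun r => h r.succ) fun r => k r.succ
    have hc := (((T.isCentral_u (h 0)).pow (k 0)))
    have hcomm : Commute ((T.u t (c 0) : H →L[ℂ] H) ^ k 0)
        (T.V (c 0) ^ k 0 * (List.ofFn fun r : Fin p => T.V (c r.succ) ^ k r.succ).prod) := by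
      refine (Commute.pow_right (hc _).1.symm _).mul_right (Commute.list_prod_right _ _ ?_)
      intro Y hY
      obtain ⟨r, rfl⟩ := (List.mem_ofFn' _ _).1 hY
      exact Commute.pow_right (hc _).1.symm _
    rw [← mul_assoc, T.V_mul_pow (h 0), mul_assoc _ (T.V t), ih]
    simpa only [mul_assoc] using congrArg (· * ((List.ofFn fun r : Fin p =>
      (T.u t (c r.succ) : H →L[ℂ] H) ^ k r.succ).prod * T.V t)) hcomm.eq

/-- V_{p_i} passes only the factors with smaller index before it joins its own power and raises k_i
by one; hence only U_{p_i p_r} with r < i appear. Injectivity of c makes these indices different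
from p_i. -/
lemma V_mul_list_prod_self {p : ℕ} (c : Fin p → Fin n) (hinj : Function.Injective c) (i : Fin p)
    (k : Fin p → ℕ) :
    T.V (c i) * (List.ofFn fun r => T.V (c r) ^ k r).prod
      = (List.ofFn fun r => T.V (c r) ^ shiftIndex i k r).prod
        * (List.ofFn fun r : Fin i.1 => (T.u (c i) (c (r.castLT (r.2.trans i.2))) : H →L[ℂ] H)
          ^ k (r.castLT (r.2.trans i.2))).prod := by
  induction p with
  | zero => exact i.elim0
  | succ p ih =>
    induction i using Fin.cases with
    | zero =>
      simp only [List.ofFn_succ, List.prod_cons]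
      simp [shiftIndex, pow_succ', mul_assoc]
    | succ i =>
      have h : c i.succ ≠ c 0 := hinj.ne (Fin.succ_ne_zero i)
      have ih := ih (fun r => c r.succ) (hinj.comp (Fin.succ_injective p)) i fun r => k r.succ
      have hc := (T.isCentral_u h).pow (k 0)
      have hlist : (List.ofFn fun r : Fin i.succ.1 =>
            (T.u (c i.succ) (c (r.castLT (r.2.trans i.succ.2))) : H →L[ℂ] H)
              ^ k (r.castLT (r.2.trans i.succ.2))).prod
          = (T.u (c i.succ) (c 0) : H →L[ℂ] H) ^ k 0
            * (List.ofFn fun r : Fin i.1 =>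
              (T.u (c i.succ) (c (r.castLT (r.2.trans i.2)).succ) : H →L[ℂ] H)
                ^ k (r.castLT (r.2.trans i.2)).succ).prod := by
        rw [← List.prod_cons]
        exact congrArg List.prod (List.ofFn_succ (n := i.1))
      have hshift : ∀ r : Fin p, shiftIndex i.succ k r.succ
          = shiftIndex i (fun r => k r.succ) r := by
        intro r
        simp [shiftIndex, Pi.single_apply]
      have hshift0 : shiftIndex i.succ k 0 = k 0 := by
        simp [shiftIndex, (Fin.succ_ne_zero i).symm]
      have hcomm : Commute ((T.u (c i.succ) (c 0) : H →L[ℂ] H) ^ k 0)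
          (T.V (c 0) ^ k 0 * (List.ofFn fun r : Fin p =>
            T.V (c r.succ) ^ shiftIndex i (fun r => k r.succ) r).prod) := by
        refine (Commute.pow_right (hc _).1.symm _).mul_right (Commute.list_prod_right _ _ ?_)
        intro Y hY
        obtain ⟨r, rfl⟩ := (List.mem_ofFn' _ _).1 hY
        exact Commute.pow_right (hc _).1.symm _
      rw [hlist]
      simp only [List.ofFn_succ (n := p), List.prod_cons, hshift, hshift0]
      rw [← mul_assoc, T.V_mul_pow h, mul_assoc _ (T.V (c i.succ)), ih]
      simpa only [mul_assoc] using congrArg (· * (List.ofFn fun r : Fin i.1 =>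
        (T.u (c i.succ) (c (r.castLT (r.2.trans i.2)).succ) : H →L[ℂ] H)
          ^ k (r.castLT (r.2.trans i.2)).succ).prod) hcomm.eq

lemma coe_list_prod_resU (A : Finset (Fin n)) (t : Fin n) {p : ℕ} (c : Fin p → Fin n)
    (h : ∀ r, t ≠ c r) (k : Fin p → ℕ) (x : T.D A) :
    (((List.ofFn fun r => (T.resU A t (c r) (h r) : T.D A →L[ℂ] T.D A) ^ k r).prod x : T.D A) : H)
      = (List.ofFn fun r => (T.u t (c r) : H →L[ℂ] H) ^ k r).prod (x : H) := by
  have hpow : ∀ (j : Fin n) (hj : t ≠ j) (s : ℕ) (y : T.D A),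
      ((((T.resU A t j hj : T.D A →L[ℂ] T.D A) ^ s) y : T.D A) : H)
        = ((T.u t j : H →L[ℂ] H) ^ s) (y : H) := by
    intro j hj s
    induction s with
    | zero => simp
    | succ s ih =>
      intro y
      rw [pow_succ, pow_succ, mul_apply_eq_comp, mul_apply_eq_comp, ih]
      rfl
  induction p with
  | zero => simp
  | succ p ih =>
    rw [List.ofFn_succ, List.ofFn_succ, List.prod_cons, List.prod_cons, mul_apply_eq_comp,
      mul_apply_eq_comp, hpow, ih (fun r => c r.succ) (fun r => h r.succ)]

lemma synthesis_mulCoord_hasSum (A : Finset (Fin n)) (i : Fin A.card)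
    (f : Hardy A.card (T.D A)) :
    HasSum (fun k => tuplePow T.V A (shiftIndex i k) (coeff A.card (T.D A) f k : H))
      (T.synthesis A (mulCoord i f)) := by
  have h := T.hasSum_synthesis A (mulCoord i f)
  rw [coeff_mulCoord, ← (shiftIndex_injective i).hasSum_iff] at h
  · simpa [Function.comp_def, shiftCoeff, (shiftIndex_injective i).extend_apply] using h
  -- Multi-indices outside the image of the shift carry zero coefficients of z_i f, so the sum may
  -- be reindexed.
  · intro k hk
    simp only [shiftCoeff]
    rw [Function.extend_apply' _ _ _ (by simpa using hk)]
    simp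

/-- Both sides are sums over k, so by uniqueness of sums it is enough to compare the terms; there
the claim is the commutation identity for V_t V_A^k. -/
lemma V_synthesis (A : Finset (Fin n)) (t : Fin n) (f : Hardy A.card (T.D A)) :
    T.V t (T.synthesis A f) = T.synthesis A (T.modelOp A t f) := by
  refine ((T.hasSum_synthesis A f).mapL (T.V t)).unique ?_
  rw [modelOp]
  split_ifs with ht
  · have hti : A.orderEmbOfFin rfl ((A.orderIsoOfFin rfl).symm ⟨t, ht⟩) = t :=
      congrArg Subtype.val ((A.orderIsoOfFin rfl).apply_symm_apply ⟨t, ht⟩)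
    refine (T.synthesis_mulCoord_hasSum A _ _).congr_fun fun k => ?_
    have h := T.V_mul_list_prod_self (A.orderEmbOfFin rfl) (A.orderEmbOfFin rfl).injective
      ((A.orderIsoOfFin rfl).symm ⟨t, ht⟩) k
    rw [hti] at h
    refine (DFunLike.congr_fun h (coeff A.card (T.D A) f k : H)).trans
      (congrArg (tuplePow T.V A (shiftIndex ((A.orderIsoOfFin rfl).symm ⟨t, ht⟩) k)) ?_)
    refine (T.coe_list_prod_resU A t _ (ne_of_lt_index A ht)
      (fun r => k (r.castLT _)) _).symm.trans ?_
    exact congrArg Subtype.val (coeff_list_prod_diagOp _ _ f k).symm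
  · refine (T.hasSum_synthesis A _).congr_fun fun k => ?_
    have hne : ∀ r, t ≠ A.orderEmbOfFin rfl r := fun r h => ht (h ▸ A.orderEmbOfFin_mem rfl r)
    rw [mul_apply_eq_comp, coeff_list_prod_diagOp, coeff_idTensor,
      T.coe_list_prod_resU A t _ hne k]
    exact DFunLike.congr_fun (T.V_mul_list_prod_of_ne t (A.orderEmbOfFin rfl) hne k)
      (coeff A.card (T.D A) f k : H)

end TwistedIsometry

end TwistedIsometries

end
theorem theorem4p3 {n : ℕ} {H : Type*} [NormedAddCommGroup H] [InnerProductSpace ℂ H]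
    [CompleteSpace H] (T : TwistedIsometries.TwistedIsometry n H) :
    TwistedIsometries.UnitarilyEquivalent T.V T.model := by
  -- Π is the inverse of the synthesis map, so the intertwining is checked on the model side,
  -- summand by summand.
  refine ⟨(LinearIsometryEquiv.ofSurjective T.modelIsometry T.modelIsometry_surjective).symm,
    fun t x => ?_⟩
  rw [LinearIsometryEquiv.symm_apply_eq]
  obtain ⟨f, rfl⟩ := T.modelIsometry_surjective x
  have h : (LinearIsometryEquiv.ofSurjective T.modelIsometry T.modelIsometry_surjective).symm
      (T.modelIsometry f) = f :=
    (LinearIsometryEquiv.ofSurjective _ T.modelIsometry_surjective).symm_apply_apply f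
  rw [h, LinearIsometryEquiv.coe_ofSurjective, T.modelIsometry_apply, T.modelIsometry_apply,
    map_sum]
  exact Finset.sum_congr rfl fun A _ => T.V_synthesis A t (f A)
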